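/- Let $\ell$ be the number of reservoirs. A *confined multisystem* is $(\mathcal H,\rho,\boldsymbol E,V)$ with $\mathcal H$ a finite-dimensional complex Hilbert space, $\rho$ a density matrix, $\boldsymbol E=(H_1,\dots,H_\ell)$ commuting self-adjoint operators and $V$ self-adjoint; put $H=\sum_jH_j+V$. Let $\mathrm{sp}\,\boldsymbol E=\{(e_1,\dots,e_\ell): e_j\in\mathrm{sp}\,H_j\}$, let $P_{\boldsymbol e}$ be the orthogonal projection onto $\{v: H_jv=e_jv\ \forall j\}$, and $\tilde\rho=\sum_{\boldsymbol e}P_{\boldsymbol e}\rho P_{\boldsymbol e}$. For $t>0$ the two-time measurement flux law is the probability measure $$\mathbb P_t(\boldsymbol\varphi)=\sum_{\boldsymbol e,\boldsymbol e'\in\mathrm{sp}\,\boldsymbol E}\mathbf 1_{\boldsymbol e'-\boldsymbol e=t\boldsymbol\varphi}\,\mathrm{tr}\big(e^{-itH}\tilde\rho P_{\boldsymbol e}e^{itH}P_{\boldsymbol e'}\big)$$ on $\mathbb R^\ell$, and $\chi_t(\boldsymbol\alpha)=\int e^{-t\boldsymbol\alpha\cdot\boldsymbol\varphi}\,d\mathbb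 P_t(\boldsymbol\varphi)$ for $\boldsymbol\alpha\in\mathbb C^\ell$ (with $\chi_0=1$). Let $(\mathcal H^{(L)},\rho^{(L)},\boldsymbol E^{(L)},V^{(L)})_{L\in\mathbb N}$ be a sequence of confined multisystems with the same $\ell$, with $\sup_L\|V^{(L)}\|<\infty$, in a multi-thermal state: there are $\beta_1,\dots,\beta_\ell>0$ with $\rho^{(L)}=e^{-\boldsymbol\beta\cdot\boldsymbol E^{(L)}}/\mathrm{tr}(e^{-\boldsymbol\beta\cdot\boldsymbol E^{(L)}})$ for all $L$. Write $\mathbb P^{(L)}_t,\chi^{(L)}_t$ for the corresponding objects. Condition (TL): for all $t\ge0$ and $\boldsymbol\alpha\in i\mathbb R^\ell$ the limit $\chi_t(\boldsymbol\alpha)=\lim_{L\to\infty}\chi_t^{(L)}(\boldsymbol\alpha)$ exists in $\mathbb C$, and $i\mathbb R^\ell\ni\boldsymbol\alpha\mapsto\chi_t(\boldsymbol\alpha)$ is continuous at $0$. Under (TL), for each $t>0$ let $\mathbb P_t$ be the weak limit of $\mathbb P^{(L)}_t$ as $L\to\infty$ (it exists by Lévy's theorem), and put $\chi_t(\boldsymbol\alpha)=\int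 e^{-t\boldsymbol\alpha\cdot\boldsymbol\varphi}\,d\mathbb P_t(\boldsymbol\varphi)\in(0,+\infty]$ for $\boldsymbol\alpha\in\mathbb R^\ell$ and $$\chi_+(\boldsymbol\alpha)=\lim_{t\to\infty}\tfrac1t\log\chi_t(\boldsymbol\alpha)\in[-\infty,+\infty]$$ where this limit exists. For $\alpha_0>0$, condition LT($\alpha_0$) says that (TL) holds and that $\chi_+(\boldsymbol\alpha)$ exists and is a real number for every $\boldsymbol\alpha\in\mathbb R^\ell$ with $\max_j|\alpha_j|<\alpha_0$. **Theorem.** Assume that LT($\alpha_0$) holds for some $\alpha_0>0$ and that $\chi_+(\boldsymbol\alpha)$ exists as an extended real number for all $\boldsymbol\alpha\in\mathbb R^\ell$. Let $\mathcal D=\{\boldsymbol\alpha\in\mathbb R^\ell:\chi_+(\boldsymbol\alpha)<+\infty\}$, $$I(\boldsymbol s)=-\inf_{\boldsymbol\alpha\in\mathbb R^\ell}\big(\boldsymbol\alpha\cdot\boldsymbol s+\chi_+(\boldsymbol\alpha)\big),\qquad \boldsymbol s\in\mathbb R^\ell,$$ and let $\mathcal F$ be the set of $\boldsymbol s\in\mathbb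 R^\ell$ for which there is $\boldsymbol\alpha\in\mathcal D$ with $\boldsymbol\alpha\cdot\boldsymbol s+I(\boldsymbol s)<\boldsymbol\alpha\cdot\boldsymbol s'+I(\boldsymbol s')$ for all $\boldsymbol s'\ne\boldsymbol s$. Then for every Borel set $B\subset\mathbb R^\ell$ $$-\inf_{\boldsymbol s\in\mathrm{int}(B)\cap\mathcal F}I(\boldsymbol s)\le\liminf_{t\to\infty}\tfrac1t\log\mathbb P_t(B)\le\limsup_{t\to\infty}\tfrac1t\log\mathbb P_t(B)\le-\inf_{\boldsymbol s\in\mathrm{cl}(B)}I(\boldsymbol s)$$ (with $\log0=-\infty$ and $\inf\emptyset=+\infty$). If moreover LT($\alpha_0$) holds for all $\alpha_0>0$ and $\chi_+$ is differentiable everywhere on $\mathbb R^\ell$, then these inequalities hold with $\mathcal F$ replaced by $\mathbb R^\ell$. -/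

import Mathlib

open MeasureTheory Filter Topology
open scoped ENNReal

universe u

/-- A confined multisystem with `ℓ` reservoirs: a finite-dimensional complex Hilbert space, a
density matrix `state`, a tuple `energy = (H₁, …, H_ℓ)` of commuting observables, and one more
observable `interaction`. -/
structure ConfinedMultisystem (ℓ : ℕ) where
  carrier : Type u
  [normed : NormedAddCommGroup carrier]
  [innerProd : InnerProductSpace ℂ carrier]
  [complete : CompleteSpace carrier]
  [finiteDim : FiniteDimensional ℂ carrier]
  state : carrier →L[ℂ] carrier
  energy : Fin ℓ → (carrier →L[ℂ] carrier)
  interaction : carrier →L[ℂ] carrier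
  state_isPositive : state.IsPositive
  state_trace : LinearMap.trace ℂ carrier (state : carrier →ₗ[ℂ] carrier) = 1
  energy_isSelfAdjoint : ∀ j, IsSelfAdjoint (energy j)
  energy_commute : ∀ i j, Commute (energy i) (energy j)
  interaction_isSelfAdjoint : IsSelfAdjoint interaction

namespace ConfinedMultisystem

attribute [instance] normed innerProd complete finiteDim

variable {ℓ : ℕ} (M : ConfinedMultisystem.{u} ℓ)

/-- The trace of an operator. -/
noncomputable def tr (A : M.carrier →L[ℂ] M.carrier) : ℂ :=
  LinearMap.trace ℂ M.carrier (A : M.carrier →ₗ[ℂ] M.carrier)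

/-- The full Hamiltonian `H = ∑ⱼ Hⱼ + V`. -/
noncomputable def hamiltonian : M.carrier →L[ℂ] M.carrier := ∑ j, M.energy j + M.interaction

/-- The unitary group `e^{i t H}`. -/
noncomputable def evolution (t : ℝ) : M.carrier →L[ℂ] M.carrier :=
  NormedSpace.exp ((Complex.I * t) • M.hamiltonian)

/-- The multi-thermal state `Z⁻¹ e^{-β·E}`, with `Z = tr e^{-β·E}`. -/
noncomputable def gibbs (β : Fin ℓ → ℝ) : M.carrier →L[ℂ] M.carrier :=
  (M.tr (NormedSpace.exp (-∑ j, (β j : ℂ) • M.energy j)))⁻¹ •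
    NormedSpace.exp (-∑ j, (β j : ℂ) • M.energy j)

theorem finite_outcomes : {e : Fin ℓ → ℝ |
    ∀ j, (e j : ℂ) ∈ spectrum ℂ (M.energy j : Module.End ℂ M.carrier)}.Finite := by
  have h : ∀ j, {a : ℝ | (a : ℂ) ∈ spectrum ℂ (M.energy j : Module.End ℂ M.carrier)}.Finite :=
    fun j => (Module.End.finite_spectrum (M.energy j : Module.End ℂ M.carrier)).preimage
      Complex.ofReal_injective.injOn
  refine (Set.Finite.pi' h).subset fun e he j => he j

/-- The set `sp E` of the possible outcomes `e = (e₁, …, e_ℓ)`, `eⱼ ∈ sp Hⱼ`, of a simultaneous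
measurement of `H₁, …, H_ℓ`. -/
noncomputable def outcomes : Finset (Fin ℓ → ℝ) := M.finite_outcomes.toFinset

/-- The joint eigenspace `{v | Hⱼ v = eⱼ v for all j}`. -/
def jointEigenspace (e : Fin ℓ → ℝ) : Submodule ℂ M.carrier :=
  ⨅ j, Module.End.eigenspace (M.energy j : Module.End ℂ M.carrier) (e j : ℂ)

/-- The joint spectral projection `P_e`. -/
noncomputable def spectralProj (e : Fin ℓ → ℝ) : M.carrier →L[ℂ] M.carrier :=
  (M.jointEigenspace e).starProjection

/-- The a priori state `∑ₑ P_e ρ P_e`. -/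
noncomputable def aprioriState : M.carrier →L[ℂ] M.carrier :=
  ∑ e ∈ M.outcomes, M.spectralProj e * M.state * M.spectralProj e

/-- The probability `tr (e^{-itH} ρ̃ P_e e^{itH} P_{e'})` that the two measurements, at the times
`0` and `t`, give `e` and then `e'`. -/
noncomputable def jointProb (t : ℝ) (e e' : Fin ℓ → ℝ) : ℂ :=
  M.tr (M.evolution (-t) * (M.aprioriState * M.spectralProj e) * M.evolution t * M.spectralProj e')

/-- The law of the flux vector `(e' - e) / t` under the two-time measurement. -/
noncomputable def fluxMeasure (t : ℝ) : Measure (Fin ℓ → ℝ) :=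
  ∑ e ∈ M.outcomes, ∑ e' ∈ M.outcomes,
    ENNReal.ofReal (M.jointProb t e e').re • Measure.dirac (t⁻¹ • (e' - e))

section Facts

theorem energy_isSymmetric (j : Fin ℓ) :
    (M.energy j : M.carrier →ₗ[ℂ] M.carrier).IsSymmetric :=
  ContinuousLinearMap.isSelfAdjoint_iff_isSymmetric.1 (M.energy_isSelfAdjoint j)

theorem mem_outcomes {e : Fin ℓ → ℝ} : e ∈ M.outcomes ↔
    ∀ j, (e j : ℂ) ∈ spectrum ℂ (M.energy j : Module.End ℂ M.carrier) := by
  simp [outcomes]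

theorem orthogonalFamily_jointEigenspace :
    OrthogonalFamily ℂ (fun e : M.outcomes => M.jointEigenspace e)
      fun e => (M.jointEigenspace e).subtypeₗᵢ := by
  have h := LinearMap.IsSymmetric.orthogonalFamily_iInf_eigenspaces
    (T := fun j => (M.energy j : M.carrier →ₗ[ℂ] M.carrier)) M.energy_isSymmetric
  exact h.comp (f := fun e : M.outcomes => fun j => ((e.1 j : ℝ) : ℂ)) (by
    intro a b hab
    ext j
    exact Complex.ofReal_injective (congrFun hab j))

theorem iSup_jointEigenspace : ⨆ e : M.outcomes, M.jointEigenspace e = ⊤ := by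
  have h := LinearMap.IsSymmetric.iSup_iInf_eq_top_of_commute
    (T := fun j => (M.energy j : M.carrier →ₗ[ℂ] M.carrier)) M.energy_isSymmetric (by
      intro i j _
      have := M.energy_commute i j
      ext v
      exact congrArg (fun A : M.carrier →L[ℂ] M.carrier => A v) this.eq)
  rw [eq_top_iff, ← h]
  refine iSup_le fun γ => ?_
  by_cases hb : (⨅ j, Module.End.eigenspace (M.energy j : Module.End ℂ M.carrier) (γ j)) = ⊥
  · exact hb.le.trans bot_le
  obtain ⟨v, hv, hv0⟩ := Submodule.exists_mem_ne_zero_of_ne_bot hb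
  have hev : ∀ j, Module.End.HasEigenvalue (M.energy j : Module.End ℂ M.carrier) (γ j) := fun j =>
    Module.End.hasEigenvalue_of_hasEigenvector ⟨(Submodule.mem_iInf _).1 hv j, hv0⟩
  have hre : ∀ j, ((γ j).re : ℂ) = γ j := fun j =>
    Complex.conj_eq_iff_re.1 ((M.energy_isSymmetric j).conj_eigenvalue_eq_self (hev j))
  have hmem : (fun j => (γ j).re) ∈ M.outcomes := by
    rw [mem_outcomes]
    intro j
    rw [hre j]
    exact (hev j).mem_spectrum
  refine le_trans ?_ (le_iSup (fun e : M.outcomes => M.jointEigenspace e) ⟨_, hmem⟩)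
  simp only [jointEigenspace, hre]
  exact le_rfl

theorem sum_spectralProj : ∑ e ∈ M.outcomes, M.spectralProj e = 1 := by
  ext v
  have h := M.orthogonalFamily_jointEigenspace.sum_projection_of_mem_iSup v
    (by rw [M.iSup_jointEigenspace]; trivial)
  rw [← Finset.sum_coe_sort]
  simpa [spectralProj] using h

theorem spectralProj_mul_self (e : Fin ℓ → ℝ) :
    M.spectralProj e * M.spectralProj e = M.spectralProj e :=
  (M.jointEigenspace e).isIdempotentElem_starProjection

theorem spectralProj_mul_of_ne {e e' : Fin ℓ → ℝ} (he : e ∈ M.outcomes) (he' : e' ∈ M.outcomes)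
    (h : e ≠ e') : M.spectralProj e * M.spectralProj e' = 0 := by
  refine Submodule.starProjection_comp_starProjection_eq_zero_iff.2 ?_
  exact M.orthogonalFamily_jointEigenspace.isOrtho
    (i := ⟨e, he⟩) (j := ⟨e', he'⟩) (by simpa using h)

theorem spectralProj_isSelfAdjoint (e : Fin ℓ → ℝ) : IsSelfAdjoint (M.spectralProj e) :=
  isSelfAdjoint_starProjection _

theorem apriori_mul {e : Fin ℓ → ℝ} (he : e ∈ M.outcomes) :
    M.aprioriState * M.spectralProj e = M.spectralProj e * M.state * M.spectralProj e := by
  rw [aprioriState, Finset.sum_mul, Finset.sum_eq_single_of_mem e he]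
  · rw [mul_assoc, M.spectralProj_mul_self]
  · intro b hb hbe
    rw [mul_assoc, M.spectralProj_mul_of_ne hb he hbe, mul_zero]

theorem hamiltonian_isSelfAdjoint : IsSelfAdjoint M.hamiltonian :=
  (isSelfAdjoint_sum _ fun j _ => M.energy_isSelfAdjoint j).add M.interaction_isSelfAdjoint

theorem star_evolution (t : ℝ) : star (M.evolution t) = M.evolution (-t) := by
  rw [evolution, evolution, NormedSpace.star_exp, star_smul, M.hamiltonian_isSelfAdjoint.star_eq]
  simp

theorem evolution_mul (t : ℝ) : M.evolution t * M.evolution (-t) = 1 := by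
  let _ : NormedAlgebra ℚ (M.carrier →L[ℂ] M.carrier) := NormedAlgebra.restrictScalars ℚ ℂ _
  rw [evolution, evolution, Complex.ofReal_neg, mul_neg, neg_smul,
    ← NormedSpace.exp_add_of_commute (Commute.refl _).neg_right, add_neg_cancel,
    NormedSpace.exp_zero]

theorem tr_mul_comm (A B : M.carrier →L[ℂ] M.carrier) : M.tr (A * B) = M.tr (B * A) :=
  LinearMap.trace_mul_comm ℂ (A : Module.End ℂ M.carrier) (B : Module.End ℂ M.carrier)

theorem tr_sum {ι : Type*} (s : Finset ι) (A : ι → (M.carrier →L[ℂ] M.carrier)) :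
    M.tr (∑ i ∈ s, A i) = ∑ i ∈ s, M.tr (A i) := by
  simp [tr]

open scoped ComplexOrder in
theorem tr_star_mul_mul_nonneg (X : M.carrier →L[ℂ] M.carrier) :
    0 ≤ M.tr (star X * M.state * X) := by
  have h : (star X * M.state * X).IsPositive := by
    have h2 := M.state_isPositive.adjoint_conj X
    rwa [← ContinuousLinearMap.star_eq_adjoint] at h2
  exact ((ContinuousLinearMap.isPositive_toLinearMap_iff _).2 h).trace_nonneg

open scoped ComplexOrder in
theorem jointProb_nonneg (t : ℝ) {e e' : Fin ℓ → ℝ} (he : e ∈ M.outcomes) :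
    0 ≤ M.jointProb t e e' := by
  have h1 : M.jointProb t e e' = M.tr (star (M.spectralProj e * M.evolution t * M.spectralProj e') *
      M.state * (M.spectralProj e * M.evolution t * M.spectralProj e')) := by
    have h2 := M.spectralProj_mul_self e'
    rw [jointProb, M.apriori_mul he]
    simp only [star_mul, M.star_evolution, (M.spectralProj_isSelfAdjoint _).star_eq]
    nth_rewrite 1 [← h2]
    rw [← mul_assoc, M.tr_mul_comm]
    simp only [mul_assoc]
  rw [h1]
  exact M.tr_star_mul_mul_nonneg _

theorem sum_jointProb (t : ℝ) :
    ∑ e ∈ M.outcomes, ∑ e' ∈ M.outcomes, M.jointProb t e e' = 1 := by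
  have h1 : ∀ e ∈ M.outcomes, ∑ e' ∈ M.outcomes, M.jointProb t e e' =
      M.tr (M.state * M.spectralProj e) := by
    intro e he
    simp only [jointProb]
    rw [← M.tr_sum, ← Finset.mul_sum, M.sum_spectralProj, mul_one, M.tr_mul_comm, ← mul_assoc,
      M.evolution_mul, one_mul, M.apriori_mul he, mul_assoc, M.tr_mul_comm, mul_assoc,
      M.spectralProj_mul_self]
  rw [Finset.sum_congr rfl h1, ← M.tr_sum, ← Finset.mul_sum, M.sum_spectralProj, mul_one]
  exact M.state_trace

instance isProbabilityMeasure_fluxMeasure (t : ℝ) : IsProbabilityMeasure (M.fluxMeasure t) := by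
  constructor
  have h : ∑ e ∈ M.outcomes, ∑ e' ∈ M.outcomes, (M.jointProb t e e').re = 1 := by
    have := congrArg Complex.re (M.sum_jointProb t)
    simpa using this
  have hn : ∀ e ∈ M.outcomes, ∀ e' ∈ M.outcomes, 0 ≤ (M.jointProb t e e').re :=
    fun e he e' _ => (Complex.nonneg_iff.1 (M.jointProb_nonneg t he)).1
  simp only [fluxMeasure, Measure.finsetSum_apply, Measure.smul_apply, measure_univ, smul_eq_mul,
    mul_one]
  rw [← ENNReal.ofReal_one, ← h, ENNReal.ofReal_sum_of_nonneg
    fun e he => Finset.sum_nonneg (hn e he)]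
  exact Finset.sum_congr rfl fun e he => (ENNReal.ofReal_sum_of_nonneg (hn e he)).symm

end Facts

/-- The law of the flux vector as a probability measure. -/
noncomputable def fluxLaw (t : ℝ) : ProbabilityMeasure (Fin ℓ → ℝ) :=
  ⟨M.fluxMeasure t, M.isProbabilityMeasure_fluxMeasure t⟩

/-- The generating function `χ_t(α) = 𝔼_t (e^{-t α·φ})` at a complex vector `α`. -/
noncomputable def genFun (t : ℝ) (α : Fin ℓ → ℂ) : ℂ :=
  ∫ φ, Complex.exp (-(t * ∑ j, α j * (φ j : ℂ))) ∂(M.fluxLaw t : Measure (Fin ℓ → ℝ))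

end ConfinedMultisystem

/-- A multi-reservoir system: a sequence of confined multisystems with the same number `ℓ` of
reservoirs. -/
structure MultiReservoirSystem (ℓ : ℕ) where
  system : ℕ → ConfinedMultisystem.{u} ℓ

namespace MultiReservoirSystem

variable {ℓ : ℕ} (S : MultiReservoirSystem.{u} ℓ)

/-- The system is in the multi-thermal state at inverse temperatures `β`. -/
def IsMultiThermal (β : Fin ℓ → ℝ) : Prop :=
  (∀ j, 0 < β j) ∧ ∀ L, (S.system L).state = (S.system L).gibbs β

/-- Uniform boundedness of the interactions: `sup_L ‖V^(L)‖ < ∞`. -/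
def BoundedInteraction : Prop :=
  BddAbove (Set.range fun L => ‖(S.system L).interaction‖)

/-- Existence of the thermodynamic limit: for `t ≥ 0` and `α ∈ iℝ^ℓ` the limit
`χ_t(α) = lim_L χ_t^(L)(α)` exists in `ℂ`, and `χ_t` is continuous at `0` on `iℝ^ℓ`.
Here `g a` stands for `χ_t(i a)`. -/
def TL : Prop :=
  ∀ t : ℝ, 0 ≤ t → ∃ g : (Fin ℓ → ℝ) → ℂ,
    (∀ a : Fin ℓ → ℝ, Tendsto (fun L => (S.system L).genFun t fun j => Complex.I * (a j : ℂ))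
      atTop (𝓝 (g a))) ∧ ContinuousAt g 0

/-- The law `ℙ_t` of the fluxes in the thermodynamic limit: the weak limit of the laws
`ℙ_t^(L)` as `L → ∞`. -/
noncomputable def fluxLaw (t : ℝ) : ProbabilityMeasure (Fin ℓ → ℝ) :=
  limUnder atTop fun L => (S.system L).fluxLaw t

/-- Under `TL` the weak limit in the definition of `fluxLaw` exists. -/
theorem tendsto_fluxLaw (hTL : S.TL) {t : ℝ} (ht : 0 < t) :
    Tendsto (fun L => (S.system L).fluxLaw t) atTop (𝓝 (S.fluxLaw t)) := by
  obtain ⟨g, hg, hg0⟩ := hTL t ht.le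
  have hc : Continuous (WithLp.toLp 2 : (Fin ℓ → ℝ) → EuclideanSpace ℝ (Fin ℓ)) :=
    PiLp.continuous_toLp 2 _
  have hc' : Continuous (WithLp.ofLp : EuclideanSpace ℝ (Fin ℓ) → (Fin ℓ → ℝ)) :=
    PiLp.continuous_ofLp 2 _
  let ν : ℕ → ProbabilityMeasure (EuclideanSpace ℝ (Fin ℓ)) := fun L =>
    ((S.system L).fluxLaw t).map hc.measurable.aemeasurable
  let f : EuclideanSpace ℝ (Fin ℓ) → ℂ := fun ξ => g (-(t⁻¹ • WithLp.ofLp ξ))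
  have hf : ContinuousAt f 0 := by
    have h1 : Continuous fun ξ : EuclideanSpace ℝ (Fin ℓ) => -(t⁻¹ • WithLp.ofLp ξ) := by fun_prop
    refine ContinuousAt.comp (g := g) ?_ h1.continuousAt
    simpa using hg0
  have hν : ∀ ξ, Tendsto (fun L => charFun (ν L : Measure (EuclideanSpace ℝ (Fin ℓ))) ξ) atTop
      (𝓝 (f ξ)) := by
    intro ξ
    refine (hg (-(t⁻¹ • WithLp.ofLp ξ))).congr fun L => ?_
    rw [charFun_apply, ConfinedMultisystem.genFun, ProbabilityMeasure.toMeasure_map,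
      integral_map hc.measurable.aemeasurable (by fun_prop)]
    congr 1
    ext φ
    congr 1
    have ht' : (t : ℂ) ≠ 0 := by exact_mod_cast ht.ne'
    simp only [PiLp.inner_apply, Finset.mul_sum, Complex.ofReal_sum, Finset.sum_mul,
      ← Finset.sum_neg_distrib]
    refine Finset.sum_congr rfl fun j _ => ?_
    simp
    field_simp
  have htight := isTightMeasureSet_of_tendsto_charFun
    (μ := fun L => (ν L : Measure (EuclideanSpace ℝ (Fin ℓ)))) hf hν
  have hcomp : IsCompact (closure (Set.range ν)) :=
    isCompact_closure_of_isTightMeasureSet (by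
      refine htight.subset ?_
      rintro m ⟨μ, ⟨L, rfl⟩, rfl⟩
      exact ⟨L, rfl⟩)
  obtain ⟨ν₀, -, hcl⟩ := hcomp.exists_mapClusterPt (f := atTop) (u := ν)
    (tendsto_principal.2 (Eventually.of_forall fun L => subset_closure (Set.mem_range_self L)))
  have hchar : ∀ ξ, charFun (ν₀ : Measure (EuclideanSpace ℝ (Fin ℓ))) ξ = f ξ := by
    intro ξ
    have hcont : Continuous fun μ : ProbabilityMeasure (EuclideanSpace ℝ (Fin ℓ)) =>
        charFun (μ : Measure (EuclideanSpace ℝ (Fin ℓ))) ξ := by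
      refine continuous_iff_continuousAt.2 fun μ => ?_
      have h := (ProbabilityMeasure.tendsto_iff_forall_integral_rclike_tendsto ℂ).1
        (tendsto_id (x := 𝓝 μ)) (BoundedContinuousFunction.innerProbChar ξ)
      simpa only [ContinuousAt, charFun_eq_integral_innerProbChar, id] using h
    have h1 : MapClusterPt (charFun (ν₀ : Measure (EuclideanSpace ℝ (Fin ℓ))) ξ) atTop
        (fun L => charFun (ν L : Measure (EuclideanSpace ℝ (Fin ℓ))) ξ) :=
      hcl.continuousAt_comp hcont.continuousAt
    exact eq_of_nhds_neBot (h1.neBot.mono (inf_le_inf_left _ (hν ξ)))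
  have hlim : Tendsto ν atTop (𝓝 ν₀) :=
    ProbabilityMeasure.tendsto_of_tendsto_charFun fun ξ => by rw [hchar ξ]; exact hν ξ
  refine tendsto_nhds_limUnder ⟨ν₀.map hc'.measurable.aemeasurable, ?_⟩
  refine (((ProbabilityMeasure.continuous_map hc').tendsto ν₀).comp hlim).congr fun L => ?_
  apply Subtype.ext
  change (Measure.map _ (Measure.map _ _) : Measure _) = _
  rw [Measure.map_map hc'.measurable hc.measurable]
  exact Measure.map_id

/-- The generating function `χ_t(α) = ∫ e^{-t α·φ} dℙ_t(φ) ∈ [0, ∞]` for `α ∈ ℝ^ℓ`. -/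
noncomputable def genFun (t : ℝ) (α : Fin ℓ → ℝ) : ℝ≥0∞ :=
  ∫⁻ φ, ENNReal.ofReal (Real.exp (-(t * (α ⬝ᵥ φ)))) ∂(S.fluxLaw t : Measure (Fin ℓ → ℝ))

/-- The rate `(1/t) log χ_t(α)`, an extended real number. -/
noncomputable def rate (α : Fin ℓ → ℝ) (t : ℝ) : EReal :=
  ((t⁻¹ : ℝ) : EReal) * ENNReal.log (S.genFun t α)

/-- `χ₊(α) = lim_{t → ∞} (1/t) log χ_t(α)`, meaningful where the limit exists. -/
noncomputable def chiPlus (α : Fin ℓ → ℝ) : EReal := limUnder atTop (S.rate α)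

/-- `χ₊(α)` exists as an extended real number. -/
def ChiPlusExists (α : Fin ℓ → ℝ) : Prop := ∃ x : EReal, Tendsto (S.rate α) atTop (𝓝 x)

/-- The large-time assumption with parameter `α₀`: the thermodynamic limit exists, `α₀ > 0`, and
`χ₊(α)` exists as a real number whenever `max_j |α_j| < α₀` (the norm of `Fin ℓ → ℝ` is the
maximum norm). -/
def LT (α₀ : ℝ) : Prop :=
  S.TL ∧ 0 < α₀ ∧
    ∀ α : Fin ℓ → ℝ, ‖α‖ < α₀ → ∃ x : ℝ, Tendsto (S.rate α) atTop (𝓝 (x : EReal))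

/-- The rate function `I(s) = -inf_α (α·s + χ₊(α))`. -/
noncomputable def rateFun (s : Fin ℓ → ℝ) : EReal :=
  -⨅ α : Fin ℓ → ℝ, (((α ⬝ᵥ s : ℝ) : EReal) + S.chiPlus α)

/-- The set `𝒟` where `χ₊ < +∞`. -/
def domain : Set (Fin ℓ → ℝ) := {α | S.chiPlus α < ⊤}

/-- The set `ℱ` of the points `s` that are exposed for `I` by some `α ∈ 𝒟`. -/
def exposed : Set (Fin ℓ → ℝ) :=
  {s | ∃ α ∈ S.domain, ∀ s' : Fin ℓ → ℝ, s' ≠ s →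
    ((α ⬝ᵥ s : ℝ) : EReal) + S.rateFun s < ((α ⬝ᵥ s' : ℝ) : EReal) + S.rateFun s'}

/-- `(1/t) log ℙ_t(B)`, an extended real number. -/
noncomputable def logProb (B : Set (Fin ℓ → ℝ)) (t : ℝ) : EReal :=
  ((t⁻¹ : ℝ) : EReal) * ENNReal.log ((S.fluxLaw t : Measure (Fin ℓ → ℝ)) B)

end MultiReservoirSystem

/-! ### The Gärtner–Ellis theorem for families of measures on `ℝ^ℓ` -/

/-! Once `χ₊` exists, the statement is the Gärtner–Ellis theorem for the laws `ℙ_t`, with the sign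
convention `e^{-t α·φ}`.

Upper bound (`decays_of_lt_legendre`): if `I(s) > a`, some `α` gives a half-space around `s` whose
mass is below `e^{-tb}` with `b > a`, by Chernoff. Finitely many half-spaces cover a compact set,
and finiteness of `χ₊` near `0` makes the mass outside a large box equally small.

Lower bound (`IsLimit.eventually_le_measure`): let `α` expose `s` and tilt `ℙ_t` by `e^{-t α·φ}`.
The rate function becomes `I(s') + α·s'`, whose only minimum is at `s`, so the upper bound for the
tilted family makes the mass away from `s` negligible against the total mass `e^{tχ₊(α)}`. Undoing
the tilt on a small ball costs little. The upper bound needs `α` interior to the domain, which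
exposure forces (`mem_interior_of_exposes`).

Differentiable case (`IsLimit.exists_exposes`): a quadratic penalty on `α` yields exposed points
arbitrarily close to any `s` with `I(s) < ∞`, with no larger `I`, so restricting to exposed points
does not change infima over open sets. -/

namespace GartnerEllis

variable {ℓ : ℕ}

/-- The exponential moment `∫ e^{-t α·φ} dν(φ)`. -/
noncomputable def expMoment (ν : Measure (Fin ℓ → ℝ)) (t : ℝ) (α : Fin ℓ → ℝ) : ℝ≥0∞ :=
  ∫⁻ φ, ENNReal.ofReal (Real.exp (-(t * (α ⬝ᵥ φ)))) ∂ν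

/-- The Legendre transform `s ↦ -inf_α (α·s + Λ(α))`. -/
noncomputable def legendre (Λ : (Fin ℓ → ℝ) → EReal) (s : Fin ℓ → ℝ) : EReal :=
  -⨅ α : Fin ℓ → ℝ, (((α ⬝ᵥ s : ℝ) : EReal) + Λ α)

/-- `ν t A` is at most `e^{-t b}` for large `t`, for some `b > a`. -/
def Decays (ν : ℝ → Measure (Fin ℓ → ℝ)) (a : ℝ) (A : Set (Fin ℓ → ℝ)) : Prop :=
  ∃ b > a, ∀ᶠ t in atTop, ν t A ≤ ENNReal.ofReal (Real.exp (-(t * b)))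

theorem coe_le_coe_add_iff (a b : ℝ) (x : EReal) :
    (a : EReal) ≤ (b : EReal) + x ↔ ((a - b : ℝ) : EReal) ≤ x := by
  induction x with
  | bot => simp [-EReal.coe_sub]
  | top => simp
  | coe x => norm_cast; exact sub_le_iff_le_add'.symm

theorem inv_mul_log_le_iff {t : ℝ} (ht : 0 < t) (x : ℝ≥0∞) (r : ℝ) :
    ((t⁻¹ : ℝ) : EReal) * ENNReal.log x ≤ (r : EReal) ↔ x ≤ ENNReal.ofReal (Real.exp (t * r)) := by
  rw [← ENNReal.log_le_log_iff, ENNReal.log_ofReal_of_pos (Real.exp_pos _), Real.log_exp]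
  have ht' : (0 : ℝ) < t⁻¹ := inv_pos.2 ht
  induction ENNReal.log x with
  | bot => rw [EReal.coe_mul_bot_of_pos ht']; simp
  | top => rw [EReal.coe_mul_top_of_pos ht']; simp [-EReal.coe_mul]
  | coe y => norm_cast; rw [inv_mul_le_iff₀ ht]

theorem lt_inv_mul_log_iff {t : ℝ} (ht : 0 < t) (x : ℝ≥0∞) (r : ℝ) :
    (r : EReal) < ((t⁻¹ : ℝ) : EReal) * ENNReal.log x ↔ ENNReal.ofReal (Real.exp (t * r)) < x := by
  rw [← not_le, inv_mul_log_le_iff ht, not_le]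

/-! ### Sublevel sets of the Legendre transform. -/

section Legendre

variable {Λ : (Fin ℓ → ℝ) → EReal}

/-- Comparing with real thresholds avoids sums of opposite infinities, since `Λ` may take both
values `⊤` and `⊥`. -/
theorem legendre_le_iff {s : Fin ℓ → ℝ} {a : ℝ} :
    legendre Λ s ≤ (a : EReal) ↔ ∀ α, ((-a - α ⬝ᵥ s : ℝ) : EReal) ≤ Λ α := by
  rw [legendre, EReal.neg_le, le_iInf_iff, ← EReal.coe_neg]
  simp only [coe_le_coe_add_iff]

theorem lt_legendre_iff {s : Fin ℓ → ℝ} {a : ℝ} :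
    (a : EReal) < legendre Λ s ↔ ∃ α, Λ α < ((-a - α ⬝ᵥ s : ℝ) : EReal) := by
  rw [← not_le, legendre_le_iff]
  simp

/-- Translating `Λ` by `α` adds the linear function `α·s` to the transform; a point exposed by `α`
thus becomes a strict minimum. -/
theorem legendre_tilt_le_iff {α s : Fin ℓ → ℝ} {a : ℝ} :
    legendre (fun γ => Λ (α + γ)) s ≤ (a : EReal) ↔
      legendre Λ s ≤ ((a - α ⬝ᵥ s : ℝ) : EReal) := by
  rw [legendre_le_iff, legendre_le_iff]
  constructor
  · intro h γ
    refine le_trans (EReal.coe_le_coe_iff.2 (le_of_eq ?_)) ((h (γ - α)).trans_eq (by simp))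
    rw [sub_dotProduct]; ring
  · intro h γ
    refine le_trans (EReal.coe_le_coe_iff.2 (le_of_eq ?_)) (h (α + γ))
    rw [add_dotProduct]; ring

theorem isOpen_lt_legendre (a : ℝ) : IsOpen {s | (a : EReal) < legendre Λ s} := by
  simp only [lt_legendre_iff, Set.ofPred_exists]
  refine isOpen_iUnion fun α => ?_
  have hc : Continuous fun s : Fin ℓ → ℝ => ((-a - α ⬝ᵥ s : ℝ) : EReal) :=
    continuous_coe_real_ereal.comp (continuous_const.sub (continuous_const.dotProduct continuous_id))
  exact isOpen_lt continuous_const hc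

theorem convex_legendre_le (a : ℝ) : Convex ℝ {s | legendre Λ s ≤ (a : EReal)} := by
  intro x hx y hy p q hp hq hpq
  simp only [Set.mem_ofPred_eq, legendre_le_iff] at hx hy ⊢
  intro α
  have h : -a - α ⬝ᵥ (p • x + q • y) = p * (-a - α ⬝ᵥ x) + q * (-a - α ⬝ᵥ y) := by
    obtain rfl : q = 1 - p := by linarith
    simp only [dotProduct_add, dotProduct_smul, smul_eq_mul]; ring
  rcases le_total (-a - α ⬝ᵥ x) (-a - α ⬝ᵥ y) with h' | h'
  · refine le_trans (EReal.coe_le_coe_iff.2 ?_) (hy α)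
    rw [h]
    calc _ ≤ p * (-a - α ⬝ᵥ y) + q * (-a - α ⬝ᵥ y) := by gcongr
      _ = _ := by rw [← add_mul, hpq, one_mul]
  · refine le_trans (EReal.coe_le_coe_iff.2 ?_) (hx α)
    rw [h]
    calc _ ≤ p * (-a - α ⬝ᵥ x) + q * (-a - α ⬝ᵥ x) := by gcongr
      _ = _ := by rw [← add_mul, hpq, one_mul]

end Legendre

/-! ### Exponential decay and the upper bound. -/

section Decays

variable {ν : ℝ → Measure (Fin ℓ → ℝ)} {a : ℝ} {A B : Set (Fin ℓ → ℝ)}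

theorem Decays.mono (h : Decays ν a B) (hAB : A ⊆ B) : Decays ν a A := by
  obtain ⟨b, hb, h⟩ := h
  exact ⟨b, hb, h.mono fun t ht => (measure_mono hAB).trans ht⟩

theorem decays_empty : Decays ν a ∅ := ⟨a + 1, by simp, by simp⟩

theorem Decays.union (hA : Decays ν a A) (hB : Decays ν a B) : Decays ν a (A ∪ B) := by
  obtain ⟨b, hb, hA⟩ := hA
  obtain ⟨c, hc, hB⟩ := hB
  have hm : a < min b c := lt_min hb hc
  -- The rate drops from `min b c` to `d`, still above `a`, to absorb the factor `2` of the union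
  -- bound.
  obtain ⟨d, had, hd⟩ := exists_between hm
  refine ⟨d, had, ?_⟩
  filter_upwards [hA, hB, eventually_ge_atTop (0 : ℝ),
    (tendsto_id.atTop_mul_const (sub_pos.2 hd)).eventually_ge_atTop (Real.log 2)] with t h1 h2 h0 h3
  refine (measure_union_le _ _).trans ((add_le_add h1 h2).trans ?_)
  rw [← ENNReal.ofReal_add (Real.exp_pos _).le (Real.exp_pos _).le]
  refine ENNReal.ofReal_le_ofReal ?_
  have e1 : Real.exp (-(t * b)) ≤ Real.exp (-(t * min b c)) :=
    Real.exp_le_exp.2 (neg_le_neg (mul_le_mul_of_nonneg_left (min_le_left _ _) h0))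
  have e2 : Real.exp (-(t * c)) ≤ Real.exp (-(t * min b c)) :=
    Real.exp_le_exp.2 (neg_le_neg (mul_le_mul_of_nonneg_left (min_le_right _ _) h0))
  have e3 : 2 * Real.exp (-(t * min b c)) ≤ Real.exp (-(t * d)) := by
    rw [← Real.exp_log (show (0 : ℝ) < 2 by norm_num), ← Real.exp_add]
    refine Real.exp_le_exp.2 ?_
    simp only [id] at h3
    linarith
  linarith

theorem decays_biUnion {ι : Type*} (s : Finset ι) {A : ι → Set (Fin ℓ → ℝ)}
    (h : ∀ i ∈ s, Decays ν a (A i)) : Decays ν a (⋃ i ∈ s, A i) := by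
  classical
  induction s using Finset.induction with
  | empty => simpa using decays_empty
  | insert i s _ ih =>
    rw [Finset.set_biUnion_insert]
    exact (h i (by simp)).union (ih fun j hj => h j (by simp [hj]))

theorem measurable_ofReal_exp (t : ℝ) (α : Fin ℓ → ℝ) :
    Measurable fun φ : Fin ℓ → ℝ => ENNReal.ofReal (Real.exp (-(t * (α ⬝ᵥ φ)))) := by
  have hc : Continuous fun x : Fin ℓ → ℝ => α ⬝ᵥ x := continuous_const.dotProduct continuous_id
  exact ENNReal.measurable_ofReal.comp (by fun_prop : Continuous _).measurable

theorem ofReal_exp_mul_measure_le {μ : Measure (Fin ℓ → ℝ)} {t r : ℝ} (ht : 0 ≤ t)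
    {α : Fin ℓ → ℝ} (hA : ∀ x ∈ A, r ≤ -(α ⬝ᵥ x)) :
    ENNReal.ofReal (Real.exp (t * r)) * μ A ≤ expMoment μ t α := by
  refine le_trans ?_ (mul_meas_ge_le_lintegral (measurable_ofReal_exp t α)
    (ENNReal.ofReal (Real.exp (t * r))))
  gcongr
  intro x hx
  refine ENNReal.ofReal_le_ofReal (Real.exp_le_exp.2 ?_)
  rw [← mul_neg]
  exact mul_le_mul_of_nonneg_left (hA x hx) ht

/-- The Chernoff bound on subsets of half-spaces. -/
theorem decays_of_le {Λ : (Fin ℓ → ℝ) → EReal}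
    (hΛ : ∀ (α : Fin ℓ → ℝ) (r : ℝ), Λ α < (r : EReal) →
      ∀ᶠ t in atTop, expMoment (ν t) t α ≤ ENNReal.ofReal (Real.exp (t * r)))
    {α : Fin ℓ → ℝ} {q r : ℝ} (hq : Λ α < (q : EReal)) (hA : ∀ x ∈ A, r ≤ -(α ⬝ᵥ x))
    (ha : a < r - q) : Decays ν a A := by
  refine ⟨r - q, ha, ?_⟩
  filter_upwards [hΛ α q hq, eventually_ge_atTop (0 : ℝ)] with t h1 h0
  have h2 := (ofReal_exp_mul_measure_le (μ := ν t) h0 hA).trans h1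
  have h3 : ν t A = ENNReal.ofReal (Real.exp (-(t * r))) *
      (ENNReal.ofReal (Real.exp (t * r)) * ν t A) := by
    rw [← mul_assoc, ← ENNReal.ofReal_mul (Real.exp_pos _).le, ← Real.exp_add]
    simp
  rw [h3]
  refine (mul_le_mul_right h2 _).trans (le_of_eq ?_)
  rw [← ENNReal.ofReal_mul (Real.exp_pos _).le, ← Real.exp_add]
  congr 2; ring

/-- The large deviation upper bound on closed sets. -/
theorem decays_of_lt_legendre {Λ : (Fin ℓ → ℝ) → EReal}
    (hΛ : ∀ (α : Fin ℓ → ℝ) (r : ℝ), Λ α < (r : EReal) →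
      ∀ᶠ t in atTop, expMoment (ν t) t α ≤ ENNReal.ofReal (Real.exp (t * r)))
    (hfin : ∀ᶠ α in 𝓝 (0 : Fin ℓ → ℝ), Λ α < ⊤)
    {C : Set (Fin ℓ → ℝ)} (hC : IsClosed C) (ha : ∀ s ∈ C, (a : EReal) < legendre Λ s) :
    Decays ν a C := by
  -- Chernoff with `α = -δσ eⱼ`, where `δ` is small enough that `Λ α < q` for some real `q`; the
  -- threshold `R = (a + q + 1) / δ` gives the rate `a + 1`.
  have htail : ∀ (j : Fin ℓ) (σ : ℝ), ∃ R : ℝ, Decays ν a {x | R ≤ σ * x j} := by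
    intro j σ
    have h1 : Tendsto (fun δ : ℝ => Pi.single (M := fun _ : Fin ℓ => ℝ) j (-(δ * σ))) (𝓝[>] 0)
        (𝓝 0) := by
      have : Continuous fun δ : ℝ => Pi.single (M := fun _ : Fin ℓ => ℝ) j (-(δ * σ)) :=
        (continuous_single j).comp (by fun_prop)
      simpa using (this.tendsto 0).mono_left nhdsWithin_le_nhds
    obtain ⟨δ, hδ, hδ0⟩ := ((h1.eventually hfin).and self_mem_nhdsWithin).exists
    obtain ⟨q, hq, -⟩ := EReal.lt_iff_exists_real_btwn.1 hδ
    refine ⟨(a + q + 1) / δ, decays_of_le hΛ (r := a + q + 1) hq ?_ (by linarith)⟩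
    intro x hx
    rw [Set.mem_ofPred_eq, div_le_iff₀ hδ0] at hx
    simp only [single_dotProduct]
    linarith
  choose R hR using fun j => htail j 1
  choose R' hR' using fun j => htail j (-1)
  let K : Set (Fin ℓ → ℝ) := Set.pi Set.univ fun j => Set.Icc (-R' j) (R j)
  have hK : IsCompact K := isCompact_univ_pi fun j => isCompact_Icc
  have hKc : Decays ν a Kᶜ := by
    refine (decays_biUnion Finset.univ fun j _ => (hR j).union (hR' j)).mono ?_
    intro x hx
    simp only [K, Set.mem_compl_iff, Set.mem_univ_pi, not_forall, Set.mem_Icc, not_and_or,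
      not_le] at hx
    obtain ⟨j, hj⟩ := hx
    simp only [Set.mem_iUnion]
    refine ⟨j, Finset.mem_univ j, ?_⟩
    rcases hj with hj | hj
    · right; simp only [Set.mem_ofPred_eq]; linarith
    · left; simp only [Set.mem_ofPred_eq]; linarith
  have hCK : Decays ν a (C ∩ K) := by
    -- Decay passes to subsets and finite unions, so on a compact set it is enough to find one
    -- decaying neighbourhood of each point.
    refine (hK.inter_left hC).induction_on decays_empty (fun s t hst ht => ht.mono hst)
      (fun s t hs ht => hs.union ht) fun s hs => ?_
    obtain ⟨α, hα⟩ := lt_legendre_iff.1 (ha s hs.1)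
    obtain ⟨q, hq, hq'⟩ := EReal.lt_iff_exists_real_btwn.1 hα
    rw [EReal.coe_lt_coe_iff] at hq'
    obtain ⟨r, hr, hr'⟩ := exists_between (show q + a < -(α ⬝ᵥ s) by linarith)
    refine ⟨{x | r < -(α ⬝ᵥ x)}, mem_nhdsWithin_of_mem_nhds (IsOpen.mem_nhds ?_ hr'),
      decays_of_le hΛ hq (r := r) (fun x hx => le_of_lt hx) (by linarith)⟩
    exact isOpen_lt continuous_const (continuous_const.dotProduct continuous_id).neg
  refine (hCK.union hKc).mono fun x hx => ?_
  by_cases hxK : x ∈ K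
  exacts [Or.inl ⟨hx, hxK⟩, Or.inr hxK]

end Decays

end GartnerEllis

/-! ### Convexity, exposed points and the lower bound. -/

namespace GartnerEllis

variable {ℓ : ℕ}

/-- `Λ(α)` is the limit of `(1/t) log ∫ e^{-t α·φ} dμ_t(φ)` as `t → ∞`. -/
def IsLimit (μ : ℝ → Measure (Fin ℓ → ℝ)) (Λ : (Fin ℓ → ℝ) → EReal) : Prop :=
  ∀ α, Tendsto (fun t : ℝ => ((t⁻¹ : ℝ) : EReal) * ENNReal.log (expMoment (μ t) t α)) atTop
    (𝓝 (Λ α))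

variable {μ : ℝ → Measure (Fin ℓ → ℝ)} {Λ : (Fin ℓ → ℝ) → EReal}

theorem IsLimit.eventually_le (h : IsLimit μ Λ) (α : Fin ℓ → ℝ) (r : ℝ) (hr : Λ α < (r : EReal)) :
    ∀ᶠ t in atTop, expMoment (μ t) t α ≤ ENNReal.ofReal (Real.exp (t * r)) := by
  filter_upwards [(h α).eventually_lt_const hr, eventually_gt_atTop 0] with t h1 h0
  exact (inv_mul_log_le_iff h0 _ _).1 h1.le

theorem IsLimit.eventually_lt (h : IsLimit μ Λ) (α : Fin ℓ → ℝ) (r : ℝ) (hr : (r : EReal) < Λ α) :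
    ∀ᶠ t in atTop, ENNReal.ofReal (Real.exp (t * r)) < expMoment (μ t) t α := by
  filter_upwards [(h α).eventually_const_lt hr, eventually_gt_atTop 0] with t h1 h0
  exact (lt_inv_mul_log_iff h0 _ _).1 h1

/-- Hölder's inequality for the exponential moments. -/
theorem expMoment_combination_le (m : Measure (Fin ℓ → ℝ)) (t : ℝ) (a b : Fin ℓ → ℝ) {p q : ℝ}
    (hp : 0 ≤ p) (hq : 0 ≤ q) (hpq : p + q = 1) :
    expMoment m t (p • a + q • b) ≤ expMoment m t a ^ p * expMoment m t b ^ q := by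
  refine le_trans (le_of_eq ?_) (ENNReal.lintegral_mul_norm_pow_le
    (measurable_ofReal_exp t a).aemeasurable (measurable_ofReal_exp t b).aemeasurable hp hq hpq)
  refine lintegral_congr fun φ => ?_
  rw [ENNReal.ofReal_rpow_of_pos (Real.exp_pos _), ENNReal.ofReal_rpow_of_pos (Real.exp_pos _),
    ← ENNReal.ofReal_mul (by positivity), ← Real.exp_mul, ← Real.exp_mul, ← Real.exp_add]
  congr 2
  simp only [add_dotProduct, smul_dotProduct, smul_eq_mul]
  ring

/-- Convexity of `Λ`, inherited from Hölder at a single large `t`. Real upper bounds stand in for `Λ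
a` and `Λ b`, which may be infinite. -/
theorem IsLimit.combination_le (h : IsLimit μ Λ) {a b : Fin ℓ → ℝ} {p q r r' : ℝ}
    (hp : 0 ≤ p) (hq : 0 ≤ q) (hpq : p + q = 1) (ha : Λ a < (r : EReal)) (hb : Λ b < (r' : EReal)) :
    Λ (p • a + q • b) ≤ ((p * r + q * r' : ℝ) : EReal) := by
  by_contra! hc
  obtain ⟨t, h1, h2, h3⟩ := ((h.eventually_le a r ha).and
    ((h.eventually_le b r' hb).and (h.eventually_lt _ _ hc))).exists
  refine absurd h3 (not_lt.2 ((expMoment_combination_le (μ t) t a b hp hq hpq).trans ?_))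
  refine (mul_le_mul' (ENNReal.rpow_le_rpow h1 hp) (ENNReal.rpow_le_rpow h2 hq)).trans
    (le_of_eq ?_)
  rw [ENNReal.ofReal_rpow_of_pos (Real.exp_pos _), ENNReal.ofReal_rpow_of_pos (Real.exp_pos _),
    ← ENNReal.ofReal_mul (by positivity), ← Real.exp_mul, ← Real.exp_mul, ← Real.exp_add]
  congr 2
  ring

theorem IsLimit.convex_domain (h : IsLimit μ Λ) : Convex ℝ {α | Λ α < ⊤} := by
  intro a ha b hb p q hp hq hpq
  obtain ⟨r, hr, -⟩ := EReal.lt_iff_exists_real_btwn.1 ha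
  obtain ⟨r', hr', -⟩ := EReal.lt_iff_exists_real_btwn.1 hb
  exact (h.combination_le hp hq hpq hr hr').trans_lt (EReal.coe_lt_top _)

/-- A hyperplane which exposes a point of the Legendre transform is interior to the domain. -/
theorem mem_interior_of_exposes (hconv : Convex ℝ {α | Λ α < ⊤})
    (h0 : ∀ᶠ α in 𝓝 (0 : Fin ℓ → ℝ), Λ α < ⊤) {s α : Fin ℓ → ℝ} {I₀ : ℝ}
    (hI : legendre Λ s = (I₀ : EReal))
    (hexp : ∀ s' : Fin ℓ → ℝ, s' ≠ s →
      ((α ⬝ᵥ s : ℝ) : EReal) + legendre Λ s < ((α ⬝ᵥ s' : ℝ) : EReal) + legendre Λ s') :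
    α ∈ interior {α | Λ α < ⊤} := by
  by_contra hα
  set D := {α | Λ α < ⊤}
  have h0D : (0 : Fin ℓ → ℝ) ∈ interior D := mem_interior_iff_mem_nhds.2 h0
  obtain ⟨f, hf⟩ := geometric_hahn_banach_open_point hconv.interior isOpen_interior hα
  have hfle : ∀ γ ∈ D, f γ ≤ f α := by
    intro γ hγ
    have hcl : γ ∈ closure (interior D) := by
      rw [hconv.closure_interior_eq_closure_of_nonempty_interior ⟨0, h0D⟩]
      exact subset_closure hγ
    exact closure_minimal (fun x hx => (hf x hx).le) (isClosed_le f.continuous continuous_const) hcl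
  let w : Fin ℓ → ℝ := fun j => -f (Pi.single j 1)
  have hw : ∀ γ : Fin ℓ → ℝ, γ ⬝ᵥ w = -f γ := by
    intro γ
    have := f.toLinearMap.pi_apply_eq_sum_univ γ
    simp only [ContinuousLinearMap.coe_coe] at this
    rw [this, dotProduct, ← Finset.sum_neg_distrib]
    refine Finset.sum_congr rfl fun j _ => ?_
    have hj : (Pi.single j 1 : Fin ℓ → ℝ) = fun i => if j = i then 1 else 0 := by
      ext i
      simp [Pi.single_apply, eq_comm]
    simp [w, hj]
  have hw0 : w ≠ 0 := by
    intro hw0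
    have h1 := hf 0 h0D
    have h2 := hw α
    rw [hw0, dotProduct_zero] at h2
    rw [map_zero] at h1
    linarith
  -- On the domain `γ·w ≥ α·w`, because `f` is largest at `α`. Hence `α·s' + I(s')` does not
  -- increase from `s` to `s + w`, against strict exposure.
  have hle : legendre Λ (s + w) ≤ ((I₀ - α ⬝ᵥ w : ℝ) : EReal) := by
    rw [legendre_le_iff]
    intro γ
    by_cases hγ : Λ γ = ⊤
    · rw [hγ]; exact le_top
    refine le_trans (EReal.coe_le_coe_iff.2 ?_) (legendre_le_iff.1 hI.le γ)
    rw [dotProduct_add, hw, hw]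
    linarith [hfle γ (lt_top_iff_ne_top.2 hγ)]
  have h1 := hexp (s + w) (by simpa using hw0)
  refine absurd h1 (not_lt.2 ((add_le_add le_rfl hle).trans (le_of_eq ?_)))
  rw [hI]
  norm_cast
  rw [dotProduct_add]
  ring

/-- The tilted family has limit functional `γ ↦ Λ(α + γ)`, so the upper bound applies to it. -/
theorem expMoment_withDensity (m : Measure (Fin ℓ → ℝ)) (t : ℝ) (α γ : Fin ℓ → ℝ) :
    expMoment (m.withDensity fun φ => ENNReal.ofReal (Real.exp (-(t * (α ⬝ᵥ φ))))) t γ =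
      expMoment m t (α + γ) := by
  rw [expMoment, lintegral_withDensity_eq_lintegral_mul _ (measurable_ofReal_exp t α)
    (measurable_ofReal_exp t γ)]
  refine lintegral_congr fun φ => ?_
  rw [Pi.mul_apply, ← ENNReal.ofReal_mul (Real.exp_pos _).le, ← Real.exp_add, add_dotProduct]
  congr 2
  ring

/-- A lower semicontinuous convex function with a strict minimum at `s` is bounded away from its
minimum outside the neighbourhoods of `s`. -/
theorem exists_forall_lt_legendre {s : Fin ℓ → ℝ} {m : ℝ} (hs : legendre Λ s ≤ (m : EReal))
    (hexp : ∀ s' : Fin ℓ → ℝ, s' ≠ s → (m : EReal) < legendre Λ s') {δ : ℝ} (hδ : 0 < δ) :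
    ∃ a > m, ∀ x ∉ Metric.ball s δ, (a : EReal) < legendre Λ x := by
  have hsph : ∃ a > m, ∀ x ∈ Metric.sphere s δ, (a : EReal) < legendre Λ x := by
    refine (isCompact_sphere s δ).induction_on (p := fun A => ∃ a > m, ∀ x ∈ A,
      (a : EReal) < legendre Λ x) ⟨m + 1, by simp, by simp⟩ ?_ ?_ ?_
    · rintro A B hAB ⟨a, ha, h⟩
      exact ⟨a, ha, fun x hx => h x (hAB hx)⟩
    · rintro A B ⟨a, ha, hA⟩ ⟨b, hb, hB⟩
      refine ⟨min a b, lt_min ha hb, ?_⟩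
      rintro x (hx | hx)
      · exact lt_of_le_of_lt (EReal.coe_le_coe_iff.2 (min_le_left _ _)) (hA x hx)
      · exact lt_of_le_of_lt (EReal.coe_le_coe_iff.2 (min_le_right _ _)) (hB x hx)
    · intro x hx
      have hxs : x ≠ s := by
        rintro rfl
        simp [hδ.ne] at hx
      obtain ⟨a, ha, ha'⟩ := EReal.lt_iff_exists_real_btwn.1 (hexp x hxs)
      exact ⟨_, mem_nhdsWithin_of_mem_nhds ((isOpen_lt_legendre a).mem_nhds ha'), a,
        EReal.coe_lt_coe_iff.1 ha, fun y hy => hy⟩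
  obtain ⟨a, ha, h⟩ := hsph
  -- Compactness settles the sphere. A point farther out in the convex sublevel set of `a` would put
  -- the whole segment to `s` in that set, including its point on the sphere.
  refine ⟨a, ha, fun x hx => ?_⟩
  by_contra! hc
  have hxs : δ ≤ ‖x - s‖ := by simpa [dist_eq_norm] using hx
  have hpos : 0 < ‖x - s‖ := hδ.trans_le hxs
  have hθ : δ / ‖x - s‖ ≤ 1 := (div_le_one hpos).2 hxs
  have hmem : s + (δ / ‖x - s‖) • (x - s) ∈ Metric.sphere s δ := by
    rw [mem_sphere_iff_norm, add_sub_cancel_left, norm_smul, norm_div, norm_norm,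
      Real.norm_of_nonneg hδ.le, div_mul_cancel₀ _ hpos.ne']
  refine absurd (h _ hmem) (not_lt.2 ?_)
  exact (convex_legendre_le a).add_smul_sub_mem
    (hs.trans (EReal.coe_le_coe_iff.2 ha.le)) hc ⟨by positivity, hθ⟩

/-- The large deviation lower bound at an exposed point. -/
theorem IsLimit.eventually_le_measure (h : IsLimit μ Λ)
    (h0 : ∀ᶠ α in 𝓝 (0 : Fin ℓ → ℝ), Λ α < ⊤) {s α : Fin ℓ → ℝ}
    (hα : Λ α < ⊤) (hexp : ∀ s' : Fin ℓ → ℝ, s' ≠ s →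
      ((α ⬝ᵥ s : ℝ) : EReal) + legendre Λ s < ((α ⬝ᵥ s' : ℝ) : EReal) + legendre Λ s')
    {G : Set (Fin ℓ → ℝ)} (hG : G ∈ 𝓝 s) {c : ℝ} (hc : (c : EReal) < -legendre Λ s) :
    ∀ᶠ t in atTop, ENNReal.ofReal (Real.exp (t * c)) ≤ μ t G := by
  -- Young–Fenchel: `c < -I(s) ≤ α·s + Λ(α)`. In particular `Λ(α)` is not `-∞`.
  have hΛc : ((c - α ⬝ᵥ s : ℝ) : EReal) < Λ α := by
    obtain ⟨c', hc1, hc2⟩ := EReal.lt_iff_exists_real_btwn.1 hc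
    have h2 : ((-(-c') - α ⬝ᵥ s : ℝ) : EReal) ≤ Λ α := legendre_le_iff.1 (by
      rw [EReal.coe_neg]; exact (EReal.lt_neg_comm.1 hc2).le) α
    refine lt_of_lt_of_le (EReal.coe_lt_coe_iff.2 ?_) h2
    linarith [EReal.coe_lt_coe_iff.1 hc1]
  obtain ⟨L, hL⟩ : ∃ L : ℝ, Λ α = (L : EReal) :=
    ⟨_, (EReal.coe_toReal hα.ne ((EReal.bot_lt_coe _).trans hΛc).ne').symm⟩
  have hIbot : ((-L - α ⬝ᵥ s : ℝ) : EReal) ≤ legendre Λ s := by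
    by_contra! hlt
    obtain ⟨a, ha, ha'⟩ := EReal.lt_iff_exists_real_btwn.1 hlt
    have h1 := legendre_le_iff.1 ha.le α
    rw [hL, EReal.coe_le_coe_iff] at h1
    rw [EReal.coe_lt_coe_iff] at ha'
    linarith
  obtain ⟨I₀, hI⟩ : ∃ I₀ : ℝ, legendre Λ s = (I₀ : EReal) := by
    refine ⟨_, (EReal.coe_toReal ?_ ((EReal.bot_lt_coe _).trans_le hIbot).ne').symm⟩
    intro htop
    rw [htop] at hc
    simp at hc
  rw [hI, EReal.coe_le_coe_iff] at hIbot
  rw [hL, EReal.coe_lt_coe_iff] at hΛc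
  have hint := mem_interior_of_exposes h.convex_domain h0 hI hexp
  -- One third of the gap is lost in the density on the ball, one in replacing `L` by `q`, and one
  -- absorbs a factor `2`.
  set ε := (L - (c - α ⬝ᵥ s)) / 3 with hε
  have hεpos : 0 < ε := by rw [hε]; linarith
  obtain ⟨δ, hδ, hball⟩ : ∃ δ > 0, Metric.ball s δ ⊆ G ∩ {x | α ⬝ᵥ s - ε < α ⬝ᵥ x} := by
    refine Metric.mem_nhds_iff.1 (inter_mem hG (IsOpen.mem_nhds ?_ ?_))
    · exact isOpen_lt continuous_const (continuous_const.dotProduct continuous_id)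
    · simpa using hεpos
  -- The tilted measures stay unnormalised, as the upper bound holds for arbitrary measures; their
  -- total mass is `expMoment (μ t) t α`.
  let ν : ℝ → Measure (Fin ℓ → ℝ) := fun t =>
    (μ t).withDensity fun φ => ENNReal.ofReal (Real.exp (-(t * (α ⬝ᵥ φ))))
  obtain ⟨a, ha, hfar⟩ := exists_forall_lt_legendre (Λ := fun γ => Λ (α + γ)) (s := s)
    (m := I₀ + α ⬝ᵥ s) (legendre_tilt_le_iff.2 (by rw [hI]; simp)) (by
      intro s' hs'
      by_contra! hcon
      have h1 := legendre_tilt_le_iff.1 hcon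
      refine absurd (hexp s' hs') (not_lt.2 ((add_le_add le_rfl h1).trans ?_))
      rw [hI]
      norm_cast
      linarith) hδ
  have hdecay : Decays ν a (Metric.ball s δ)ᶜ := by
    refine decays_of_lt_legendre (Λ := fun γ => Λ (α + γ)) ?_ ?_ Metric.isOpen_ball.isClosed_compl
      hfar
    · intro γ r hr
      simp only [ν, expMoment_withDensity]
      exact h.eventually_le _ _ hr
    · have hcont : Tendsto (fun γ : Fin ℓ → ℝ => α + γ) (𝓝 0) (𝓝 α) := by
        have : Continuous fun γ : Fin ℓ → ℝ => α + γ := by fun_prop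
        simpa using this.tendsto 0
      exact hcont.eventually (mem_interior_iff_mem_nhds.1 hint)
  obtain ⟨b, hb, hdecay⟩ := hdecay
  -- Here `b > a > I₀ + α·s ≥ -L`; the easy Young–Fenchel inequality is enough, without biduality.
  have hbL : -b < L := by linarith
  obtain ⟨q, hq1, hq2⟩ := exists_between (max_lt hbL (show L - ε < L by linarith))
  have hq3 : -b < q := (le_max_left _ _).trans_lt hq1
  have hq4 : L - ε < q := (le_max_right _ _).trans_lt hq1
  filter_upwards [hdecay, h.eventually_lt α q (by rw [hL]; exact_mod_cast hq2),
    eventually_ge_atTop (0 : ℝ),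
    (tendsto_id.atTop_mul_const (show 0 < q + b by linarith)).eventually_ge_atTop (Real.log 2),
    (tendsto_id.atTop_mul_const hεpos).eventually_ge_atTop (Real.log 2)] with t h1 h2 ht h3 h4
  simp only [id] at h3 h4
  have hνball : ν t (Metric.ball s δ) ≤
      ENNReal.ofReal (Real.exp (-(t * (α ⬝ᵥ s - ε)))) * μ t G := by
    simp only [ν]
    rw [withDensity_apply _ measurableSet_ball]
    refine (setLIntegral_mono measurable_const fun x hx => ENNReal.ofReal_le_ofReal
      (Real.exp_le_exp.2 (neg_le_neg (mul_le_mul_of_nonneg_left (hball hx).2.le ht)))).trans ?_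
    rw [setLIntegral_const]
    gcongr
    exact fun x hx => (hball hx).1
  have htot : expMoment (μ t) t α ≤ ν t (Metric.ball s δ) + ν t (Metric.ball s δ)ᶜ := by
    rw [measure_add_measure_compl measurableSet_ball]
    simp only [ν]
    rw [withDensity_apply _ MeasurableSet.univ, Measure.restrict_univ]
    rfl
  have hsum := h2.le.trans (htot.trans (add_le_add hνball h1))
  have hexp1 : 2 * Real.exp (-(t * b)) ≤ Real.exp (t * q) := by
    rw [← Real.exp_log (show (0 : ℝ) < 2 by norm_num), ← Real.exp_add]
    exact Real.exp_le_exp.2 (by linarith)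
  have hexp2 : 2 * Real.exp (t * c) ≤ Real.exp (t * (α ⬝ᵥ s - ε)) * Real.exp (t * q) := by
    rw [← Real.exp_log (show (0 : ℝ) < 2 by norm_num), ← Real.exp_add, ← Real.exp_add]
    refine Real.exp_le_exp.2 ?_
    have : c + ε ≤ α ⬝ᵥ s - ε + q := by rw [hε] at hq4 ⊢; linarith
    nlinarith [mul_le_mul_of_nonneg_left this ht]
  rcases eq_or_ne (μ t G) ⊤ with htop | htop
  · rw [htop]; exact le_top
  rw [ENNReal.ofReal_le_iff_le_toReal htop]
  rw [← ENNReal.ofReal_toReal htop, ← ENNReal.ofReal_mul (Real.exp_pos _).le,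
    ← ENNReal.ofReal_add (by positivity) (Real.exp_pos _).le,
    ENNReal.ofReal_le_ofReal_iff (by positivity)] at hsum
  have h5 : Real.exp (t * q) / 2 ≤ Real.exp (-(t * (α ⬝ᵥ s - ε))) * (μ t G).toReal := by linarith
  have h6 := mul_le_mul_of_nonneg_left h5 (Real.exp_pos (t * (α ⬝ᵥ s - ε))).le
  rw [← mul_assoc, ← Real.exp_add, add_neg_cancel, Real.exp_zero, one_mul] at h6
  linarith

end GartnerEllis

/-! ### Approximation by exposed points in the differentiable case. -/

namespace GartnerEllis

variable {ℓ : ℕ} {μ : ℝ → Measure (Fin ℓ → ℝ)} {Λ : (Fin ℓ → ℝ) → EReal}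

/-- The norm on `Fin ℓ → ℝ` is the maximum norm, while the penalty below is Euclidean. -/
theorem sq_norm_le_dotProduct (α : Fin ℓ → ℝ) : ‖α‖ ^ 2 ≤ α ⬝ᵥ α := by
  have hnn : 0 ≤ α ⬝ᵥ α := Finset.sum_nonneg fun j _ => mul_self_nonneg (α j)
  refine (Real.le_sqrt (norm_nonneg _) hnn).1 ((pi_norm_le_iff_of_nonneg (Real.sqrt_nonneg _)).2
    fun j => Real.le_sqrt_of_sq_le ?_)
  rw [Real.norm_eq_abs, sq_abs, sq]
  exact Finset.single_le_sum (f := fun j => α j * α j) (fun j _ => mul_self_nonneg _)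
    (Finset.mem_univ j)

theorem IsLimit.convexOn (h : IsLimit μ Λ) {L : (Fin ℓ → ℝ) → ℝ} (hL : ∀ α, Λ α = (L α : EReal)) :
    ConvexOn ℝ Set.univ L := by
  refine ⟨convex_univ, fun a _ b _ p q hp hq hpq => ?_⟩
  refine le_of_forall_pos_le_add fun η hη => ?_
  have h1 := h.combination_le (r := L a + η) (r' := L b + η) hp hq hpq
    (by rw [hL]; exact_mod_cast lt_add_of_pos_right _ hη)
    (by rw [hL]; exact_mod_cast lt_add_of_pos_right _ hη)
  rw [hL, EReal.coe_le_coe_iff] at h1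
  simp only [smul_eq_mul]
  have : p * (L a + η) + q * (L b + η) = p * L a + q * L b + (p + q) * η := by ring
  rwa [this, hpq, one_mul] at h1

/-- The points `-∇L(α)` are exposed by `α`. -/
theorem exposes_of_forall_le {L : (Fin ℓ → ℝ) → ℝ} (hL : ∀ α, Λ α = (L α : EReal))
    {α s : Fin ℓ → ℝ} (hd : DifferentiableAt ℝ L α)
    (hs : ∀ γ, L α + α ⬝ᵥ s ≤ L γ + γ ⬝ᵥ s) (s' : Fin ℓ → ℝ) (hs' : s' ≠ s) :
    ((α ⬝ᵥ s : ℝ) : EReal) + legendre Λ s < ((α ⬝ᵥ s' : ℝ) : EReal) + legendre Λ s' := by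
  have hle : legendre Λ s ≤ ((-(L α + α ⬝ᵥ s) : ℝ) : EReal) := by
    rw [legendre_le_iff]
    intro γ
    rw [hL, EReal.coe_le_coe_iff]
    linarith [hs γ]
  refine lt_of_le_of_lt (add_le_add le_rfl hle) ?_
  by_contra! hcon
  have hle' : legendre Λ s' ≤ ((-(L α + α ⬝ᵥ s') : ℝ) : EReal) := by
    revert hcon
    induction legendre Λ s' with
    | bot => simp
    | top => rw [EReal.coe_add_top]; norm_cast; simp [-EReal.coe_neg, -EReal.coe_add]
    | coe x => norm_cast; intro h; linarith
  -- If `s'` did at least as well as `s`, then `α` would also minimise `L γ + γ·s'`, and both `-s`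
  -- and `-s'` would be the gradient of `L` at `α`.
  have hs2 : ∀ γ, L α + α ⬝ᵥ s' ≤ L γ + γ ⬝ᵥ s' := by
    intro γ
    have := legendre_le_iff.1 hle' γ
    rw [hL, EReal.coe_le_coe_iff] at this
    linarith
  have hlin : ∀ x : Fin ℓ → ℝ, ∃ A : (Fin ℓ → ℝ) →L[ℝ] ℝ, ∀ γ, A γ = γ ⬝ᵥ x := by
    intro x
    refine ⟨LinearMap.toContinuousLinearMap
      { toFun := fun γ => γ ⬝ᵥ x, map_add' := fun a b => add_dotProduct a b x,
        map_smul' := fun c a => smul_dotProduct c a x }, fun γ => rfl⟩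
  have hcrit : ∀ x : Fin ℓ → ℝ, (∀ γ, L α + α ⬝ᵥ x ≤ L γ + γ ⬝ᵥ x) →
      ∀ v, fderiv ℝ L α v = -(v ⬝ᵥ x) := by
    intro x hx v
    obtain ⟨A, hA⟩ := hlin x
    have hmin : IsLocalMin (fun γ => L γ + A γ) α :=
      Eventually.of_forall fun γ => by simpa only [hA] using hx γ
    have h0 := hmin.hasFDerivAt_eq_zero (hd.hasFDerivAt.add A.hasFDerivAt)
    have := congrArg (fun B : (Fin ℓ → ℝ) →L[ℝ] ℝ => B v) h0
    simp only [add_apply, zero_apply, hA] at this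
    linarith
  refine hs' (funext fun j => ?_)
  have h1 := hcrit s hs (Pi.single j 1)
  rw [hcrit s' hs2] at h1
  simpa using h1

/-- If `Λ` is real and differentiable, a point of the domain of the Legendre transform is a limit
of exposed points at which the transform is not larger. -/
theorem IsLimit.exists_exposes (h : IsLimit μ Λ) {L : (Fin ℓ → ℝ) → ℝ}
    (hL : ∀ α, Λ α = (L α : EReal)) (hd : Differentiable ℝ L) {s : Fin ℓ → ℝ}
    (hs : legendre Λ s < ⊤) {G : Set (Fin ℓ → ℝ)} (hG : G ∈ 𝓝 s) :
    ∃ x ∈ G, legendre Λ x ≤ legendre Λ s ∧ ∃ α, ∀ s' : Fin ℓ → ℝ, s' ≠ x →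
      ((α ⬝ᵥ x : ℝ) : EReal) + legendre Λ x < ((α ⬝ᵥ s' : ℝ) : EReal) + legendre Λ s' := by
  obtain ⟨I₀, hI, -⟩ := EReal.lt_iff_exists_real_btwn.1 hs
  have hconv := h.convexOn hL
  have hlow : ∀ {a : ℝ}, legendre Λ s ≤ (a : EReal) → ∀ α, -a ≤ L α + α ⬝ᵥ s := by
    intro a ha α
    have := legendre_le_iff.1 ha α
    rw [hL, EReal.coe_le_coe_iff] at this
    linarith
  have hK : 0 ≤ L 0 + I₀ := by
    have := hlow hI.le 0
    rw [zero_dotProduct] at this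
    linarith
  obtain ⟨η, hη, hball⟩ := Metric.mem_nhds_iff.1 hG
  -- Comparing the penalised minimiser `α` with `0` gives `δ α·α ≤ 2(L 0 + I₀)`, so this choice
  -- keeps `δ • α` shorter than `η`.
  obtain ⟨δ, hδ, hδ'⟩ : ∃ δ > 0, δ * (2 * (L 0 + I₀)) < η ^ 2 := by
    refine ⟨η ^ 2 / (2 * (L 0 + I₀) + 1), by positivity, ?_⟩
    rw [div_mul_eq_mul_div, div_lt_iff₀ (by positivity)]
    have : 0 < η ^ 2 := by positivity
    nlinarith
  have hcont : Continuous fun α : Fin ℓ → ℝ => L α + α ⬝ᵥ s + δ / 2 * (α ⬝ᵥ α) :=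
    (hd.continuous.add (continuous_id.dotProduct continuous_const)).add
      (continuous_const.mul (continuous_id.dotProduct continuous_id))
  have hcoer : Tendsto (fun α : Fin ℓ → ℝ => L α + α ⬝ᵥ s + δ / 2 * (α ⬝ᵥ α))
      (cocompact _) atTop := by
    refine tendsto_atTop_mono (f := fun α : Fin ℓ → ℝ => -I₀ + δ / 2 * ‖α‖ ^ 2) (fun α => ?_) ?_
    · exact add_le_add (hlow hI.le α)
        (mul_le_mul_of_nonneg_left (sq_norm_le_dotProduct α) (by positivity))
    · refine tendsto_atTop_add_const_left _ _ (Tendsto.const_mul_atTop (by positivity) ?_)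
      exact (tendsto_pow_atTop two_ne_zero).comp tendsto_norm_cocompact_atTop
  obtain ⟨α, hα⟩ := hcont.exists_forall_le hcoer
  -- First-order condition for the penalised minimum: move from `α` towards `γ` by `τ`, bound `L` by
  -- convexity, divide by `τ` and let `τ → 0`.
  have hmin : ∀ γ, L α + α ⬝ᵥ (s + δ • α) ≤ L γ + γ ⬝ᵥ (s + δ • α) := by
    intro γ
    set v := γ - α with hv
    have hstep : ∀ τ : ℝ, 0 < τ → τ ≤ 1 →
        0 ≤ L γ - L α + v ⬝ᵥ (s + δ • α) + τ * (δ / 2 * (v ⬝ᵥ v)) := by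
      intro τ h0 h1
      have hc := hconv.2 (Set.mem_univ α) (Set.mem_univ γ) (sub_nonneg.2 h1) h0.le (by ring)
      have hp : (1 - τ) • α + τ • γ = α + τ • v := by rw [hv]; module
      rw [hp] at hc
      have hm := hα (α + τ • v)
      simp only [smul_eq_mul] at hc
      simp only [add_dotProduct, dotProduct_add, smul_dotProduct, dotProduct_smul, smul_eq_mul,
        dotProduct_comm α v] at hm ⊢
      have : 0 ≤ τ * (L γ - L α + (v ⬝ᵥ s + δ * (v ⬝ᵥ α)) + τ * (δ / 2 * (v ⬝ᵥ v))) := by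
        linarith
      exact nonneg_of_mul_nonneg_right this h0
    have hlim : Tendsto (fun τ : ℝ => L γ - L α + v ⬝ᵥ (s + δ • α) + τ * (δ / 2 * (v ⬝ᵥ v)))
        (𝓝[>] 0) (𝓝 (L γ - L α + v ⬝ᵥ (s + δ • α))) := by
      have : Continuous fun τ : ℝ => L γ - L α + v ⬝ᵥ (s + δ • α) + τ * (δ / 2 * (v ⬝ᵥ v)) := by
        fun_prop
      simpa using (this.tendsto 0).mono_left nhdsWithin_le_nhds
    have hge : 0 ≤ L γ - L α + v ⬝ᵥ (s + δ • α) := ge_of_tendsto hlim (by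
      filter_upwards [Ioc_mem_nhdsGT (zero_lt_one' ℝ)] with τ hτ using hstep τ hτ.1 hτ.2)
    rw [hv, sub_dotProduct] at hge
    linarith
  have hnn : 0 ≤ α ⬝ᵥ α := (sq_nonneg _).trans (sq_norm_le_dotProduct α)
  refine ⟨s + δ • α, hball ?_, ?_, α, exposes_of_forall_le hL (hd α) hmin⟩
  · rw [mem_ball_iff_norm, add_sub_cancel_left, norm_smul, Real.norm_of_nonneg hδ.le]
    refine lt_of_pow_lt_pow_left₀ 2 hη.le (lt_of_le_of_lt ?_ hδ')
    have h1 := hα 0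
    simp only [zero_dotProduct, mul_zero, add_zero] at h1
    have h2 := hlow hI.le α
    have h3 : δ * (α ⬝ᵥ α) ≤ 2 * (L 0 + I₀) := by linarith
    calc (δ * ‖α‖) ^ 2 = δ * (δ * ‖α‖ ^ 2) := by ring
      _ ≤ δ * (δ * (α ⬝ᵥ α)) := by gcongr; exact sq_norm_le_dotProduct α
      _ ≤ δ * (2 * (L 0 + I₀)) := by gcongr
  -- At `x = s + δ • α` the minimum of `L γ + γ·x` is `L α + α·s + δ α·α`, and the penalty term only
  -- raises it, so `I(x) ≤ I(s)`.
  · refine EReal.le_of_forall_lt_iff_le.1 fun a ha => ?_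
    rw [legendre_le_iff]
    intro γ
    rw [hL, EReal.coe_le_coe_iff]
    have h1 := hlow ha.le α
    have h2 := hmin γ
    have h3 : 0 ≤ δ * (α ⬝ᵥ α) := by positivity
    simp only [dotProduct_add, dotProduct_smul, smul_eq_mul] at h2 ⊢
    linarith

end GartnerEllis

/-! ### Application to the flux laws. -/

namespace MultiReservoirSystem

open GartnerEllis

variable {ℓ : ℕ} (S : MultiReservoirSystem.{u} ℓ)

/-- Existence of the limit is what turns the `limUnder` in `chiPlus` from a default value into the
actual limit. -/
theorem isLimit_chiPlus (hχ : ∀ α : Fin ℓ → ℝ, S.ChiPlusExists α) :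
    IsLimit (fun t => (S.fluxLaw t : Measure (Fin ℓ → ℝ))) S.chiPlus :=
  fun α => tendsto_nhds_limUnder (hχ α)

theorem LT.chiPlus_eq_coe {S : MultiReservoirSystem.{u} ℓ} {a : ℝ} (h : S.LT a) {α : Fin ℓ → ℝ}
    (hα : ‖α‖ < a) : ∃ x : ℝ, S.chiPlus α = (x : EReal) := by
  obtain ⟨x, hx⟩ := h.2.2 α hα
  exact ⟨x, hx.limUnder_eq⟩

theorem LT.eventually_chiPlus_lt_top {S : MultiReservoirSystem.{u} ℓ} {a : ℝ} (h : S.LT a) :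
    ∀ᶠ α in 𝓝 (0 : Fin ℓ → ℝ), S.chiPlus α < ⊤ := by
  filter_upwards [Metric.ball_mem_nhds (0 : Fin ℓ → ℝ) h.2.1] with α hα
  obtain ⟨x, hx⟩ := h.chiPlus_eq_coe (mem_ball_zero_iff.1 hα)
  rw [hx]
  exact EReal.coe_lt_top x

theorem limsup_logProb_le (hχ : ∀ α : Fin ℓ → ℝ, S.ChiPlusExists α) {a : ℝ} (h : S.LT a)
    (B : Set (Fin ℓ → ℝ)) :
    limsup (S.logProb B) atTop ≤ -(⨅ s ∈ closure B, S.rateFun s) := by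
  rw [EReal.le_neg]
  refine EReal.ge_of_forall_gt_iff_ge.1 fun c hc => ?_
  rw [EReal.le_neg]
  obtain ⟨b, hb, hdecay⟩ := decays_of_lt_legendre (S.isLimit_chiPlus hχ).eventually_le
    h.eventually_chiPlus_lt_top (isClosed_closure (s := B))
    fun s hs => lt_of_lt_of_le hc (iInf₂_le s hs)
  refine limsup_le_of_le (h := ?_)
  filter_upwards [hdecay, eventually_gt_atTop 0] with t h1 h0
  rw [← EReal.coe_neg]
  refine (inv_mul_log_le_iff h0 _ _).2 ((measure_mono subset_closure).trans (h1.trans ?_))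
  refine ENNReal.ofReal_le_ofReal (Real.exp_le_exp.2 ?_)
  rw [← mul_neg]
  exact mul_le_mul_of_nonneg_left (neg_le_neg hb.le) h0.le

theorem le_liminf_logProb (hχ : ∀ α : Fin ℓ → ℝ, S.ChiPlusExists α) {a : ℝ} (h : S.LT a)
    (B : Set (Fin ℓ → ℝ)) :
    -(⨅ s ∈ interior B ∩ S.exposed, S.rateFun s) ≤ liminf (S.logProb B) atTop := by
  rw [EReal.neg_le]
  refine le_iInf₂ fun s hs => ?_
  obtain ⟨hsB, α, hα, hexp⟩ := hs
  rw [EReal.neg_le]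
  refine EReal.ge_of_forall_gt_iff_ge.1 fun c hc => ?_
  refine le_liminf_of_le (h := ?_)
  filter_upwards [(S.isLimit_chiPlus hχ).eventually_le_measure h.eventually_chiPlus_lt_top hα hexp
    (mem_interior_iff_mem_nhds.1 hsB) hc, eventually_gt_atTop 0] with t h1 h0
  by_contra! hlt
  obtain ⟨c', hc1, hc2⟩ := EReal.lt_iff_exists_real_btwn.1 hlt
  refine absurd (h1.trans ((inv_mul_log_le_iff h0 _ _).1 hc1.le)) (not_le.2 ?_)
  refine (ENNReal.ofReal_lt_ofReal_iff (Real.exp_pos _)).2 (Real.exp_lt_exp.2 ?_)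
  exact mul_lt_mul_of_pos_left (EReal.coe_lt_coe_iff.1 hc2) h0

theorem iInf_exposed_le (hχ : ∀ α : Fin ℓ → ℝ, S.ChiPlusExists α) (h : ∀ a : ℝ, 0 < a → S.LT a)
    (hd : Differentiable ℝ (fun α : Fin ℓ → ℝ => (S.chiPlus α).toReal)) (B : Set (Fin ℓ → ℝ)) :
    ⨅ s ∈ interior B ∩ S.exposed, S.rateFun s ≤ ⨅ s ∈ interior B, S.rateFun s := by
  refine le_iInf₂ fun s hs => ?_
  rcases eq_or_ne (S.rateFun s) ⊤ with htop | htop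
  · rw [htop]; exact le_top
  -- `LT` at every radius makes `χ₊` real everywhere, so `toReal` loses nothing and every `α` lies
  -- in the domain.
  have hreal : ∀ α, S.chiPlus α = ((S.chiPlus α).toReal : EReal) := by
    intro α
    obtain ⟨x, hx⟩ := (h (‖α‖ + 1) (by positivity)).chiPlus_eq_coe (lt_add_one _)
    rw [hx, EReal.toReal_coe]
  obtain ⟨x, hx, hle, α, hexp⟩ := (S.isLimit_chiPlus hχ).exists_exposes hreal hd
    (lt_top_iff_ne_top.2 htop) (isOpen_interior.mem_nhds hs)
  refine (iInf₂_le x ⟨hx, α, ?_, hexp⟩).trans hle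
  change S.chiPlus α < ⊤
  rw [hreal]
  exact EReal.coe_lt_top _

end MultiReservoirSystem

theorem mainTheorem8 {ℓ : ℕ} (S : MultiReservoirSystem.{u} ℓ) (β : Fin ℓ → ℝ)
    (hβ : S.IsMultiThermal β) (hV : S.BoundedInteraction) (α₀ : ℝ) (hLT : S.LT α₀)
    (hχ : ∀ α : Fin ℓ → ℝ, S.ChiPlusExists α) :
    (∀ B : Set (Fin ℓ → ℝ), MeasurableSet B →
      -(⨅ s ∈ interior B ∩ S.exposed, S.rateFun s) ≤ liminf (S.logProb B) atTop ∧
      liminf (S.logProb B) atTop ≤ limsup (S.logProb B) atTop ∧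
      limsup (S.logProb B) atTop ≤ -(⨅ s ∈ closure B, S.rateFun s)) ∧
    ((∀ a : ℝ, 0 < a → S.LT a) →
      Differentiable ℝ (fun α : Fin ℓ → ℝ => (S.chiPlus α).toReal) →
      ∀ B : Set (Fin ℓ → ℝ), MeasurableSet B →
        -(⨅ s ∈ interior B, S.rateFun s) ≤ liminf (S.logProb B) atTop ∧
        liminf (S.logProb B) atTop ≤ limsup (S.logProb B) atTop ∧
        limsup (S.logProb B) atTop ≤ -(⨅ s ∈ closure B, S.rateFun s)) := by
  have hupper := S.limsup_logProb_le hχ hLT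
  have hlower := S.le_liminf_logProb hχ hLT
  have hmid : ∀ B, liminf (S.logProb B) atTop ≤ limsup (S.logProb B) atTop :=
    fun B => liminf_le_limsup
  refine ⟨fun B _ => ⟨hlower B, hmid B, hupper B⟩, fun hall hd B _ => ⟨?_, hmid B, hupper B⟩⟩
  exact (EReal.neg_le_neg_iff.2 (S.iInf_exposed_le hχ hall hd B)).trans (hlower B)
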